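/- All logarithms are base 2, and $\{0,1\}$ is identified with $\mathbb F_2$. The min-entropy of a distribution $\mathbf X$ on $\{0,1\}^n$ is $\mathrm H_\infty(\mathbf X)=\min_{x\in\mathrm{supp}(\mathbf X)}-\log\Pr[\mathbf X=x]$. A function $g:\{0,1\}^n\to\{0,1\}$ is an $\varepsilon$-extractor for $\mathbf X$ if the statistical distance $\frac12\sum_{b\in\{0,1\}}\left|\Pr[g(\mathbf X)=b]-\frac12\right|$ between $g(\mathbf X)$ and a uniform bit is at most $\varepsilon$. A uniformly random degree-$d$ polynomial is a uniformly random element of the finite set of all polynomials in $\mathbb F_2[X_1,\dots,X_n]$ of total degree at most $d$ and of degree at most $1$ in each variable. For real $\ell\ge 0$ put $\binom{\ell}{\le d}=\sum_{i=0}^{d}\binom{\ell}{i}$ with $\binom{\ell}{i}=\ell(\ell-1)\cdots(\ell-i+1)/i!$, and for $\ell<0$ put $\binom{\ell}{\le d}=0$. **Theorem.** Let $n,d,k\ge 1$ be integers and let $\varepsilon>0$ be real. Then for every distribution $\mathbf X$ on $\{0,1\}^n$ with $\mathrm H_\infty(\mathbf X)\ge k$, a uniformly random degree-$d$ polynomial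 $f$ is an $\varepsilon$-extractor for $\mathbf X$, that is, $$\left|\Pr_{x\sim\mathbf X}[f(x)=1]-\tfrac12\right|\le\varepsilon,$$ with probability (over the choice of $f$) at least $$1-e^{\,3n-\varepsilon^2\binom{\ell}{\le d}/(Cn^2)},\qquad\text{where } \ell=\frac k2-\log\frac{32n}{\varepsilon}\ \text{ and }\ C=7\cdot 32^2 .$$ -/

import Mathlib

open scoped BigOperators

noncomputable section

/-- The statistical distance of two distributions on a finite domain. -/
def statDist {α : Type*} [Fintype α] (A B : PMF α) : ℝ :=
  (1 / 2) * ∑ x, |(A x).toReal - (B x).toReal|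

/-- The min-entropy (in bits) of a distribution `X` on `{0,1}^n`, where `{0,1}` is identified
with the field of two elements: the minimum over the (nonempty, finite) support of `X` of
`-log₂ Pr[X = x]`. -/
def minEntropy {n : ℕ} (X : PMF (Fin n → ZMod 2)) : ℝ :=
  ⨅ x : X.support, -Real.logb 2 (X (x : Fin n → ZMod 2)).toReal

/-- A function `{0,1}^n → {0,1}` is an `ε`-extractor for the source `X` if its output on `X` is
`ε`-close to the uniform distribution on `{0,1}`. -/
def IsExtractorFor {n : ℕ} (g : (Fin n → ZMod 2) → ZMod 2) (ε : ℝ)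
    (X : PMF (Fin n → ZMod 2)) : Prop :=
  statDist (X.map g) (PMF.uniformOfFintype (ZMod 2)) ≤ ε

/-- The polynomials in `F_2[X_1, …, X_n]` of total degree at most `d` and individual degrees at
most `1`. -/
def polySet (n d : ℕ) : Set (MvPolynomial (Fin n) (ZMod 2)) :=
  {f | f.totalDegree ≤ d ∧ ∀ i, f.degreeOf i ≤ 1}

theorem polySet_finite (n d : ℕ) : (polySet n d).Finite := by
  classical
  have hM : ((Set.univ : Set (Fin n)).pi fun _ => Set.Iic 1 : Set (Fin n → ℕ)).Finite :=
    Set.Finite.pi fun _ => Set.finite_Iic 1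
  have hM' : {m : Fin n →₀ ℕ | ∀ i, m i ≤ 1}.Finite := by
    refine Set.Finite.subset (hM.preimage (f := fun m : Fin n →₀ ℕ => (m : Fin n → ℕ))
      (DFunLike.coe_injective.injOn)) ?_
    intro m hm
    exact fun i _ => hm i
  have : Finite {m : Fin n →₀ ℕ | ∀ i, m i ≤ 1} := hM'
  let φ : MvPolynomial (Fin n) (ZMod 2) → ({m : Fin n →₀ ℕ | ∀ i, m i ≤ 1} → ZMod 2) :=
    fun f m => f.coeff m
  refine Set.Finite.of_injOn (f := φ) (t := Set.univ) (fun _ _ => Set.mem_univ _) ?_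
    Set.finite_univ
  intro f hf g hg hfg
  ext m
  by_cases hm : ∀ i, m i ≤ 1
  · exact congrFun hfg ⟨m, hm⟩
  · have key : ∀ h ∈ polySet n d, h.coeff m = 0 := by
      intro h hh
      by_contra hne
      exact hm fun i =>
        (MvPolynomial.monomial_le_degreeOf i (MvPolynomial.mem_support_iff.2 hne)).trans (hh.2 i)
    rw [key f hf, key g hg]

/-- The finite set of all degree-`d` (that is, of total degree at most `d`) multilinear
polynomials over `F_2` in `n` variables. -/
def lowDegreePolys (n d : ℕ) : Finset (MvPolynomial (Fin n) (ZMod 2)) :=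
  (polySet_finite n d).toFinset

theorem lowDegreePolys_nonempty (n d : ℕ) : (lowDegreePolys n d).Nonempty :=
  ⟨0, by simp [lowDegreePolys, polySet]⟩

open Classical in
/-- The probability that a uniformly random degree-`d` polynomial over `F_2` in `n` variables
satisfies `P`. -/
def probRandomPoly (n d : ℕ) (P : MvPolynomial (Fin n) (ZMod 2) → Prop) : ℝ :=
  (((lowDegreePolys n d).filter P).card : ℝ) / ((lowDegreePolys n d).card : ℝ)

/-- The binomial coefficient `ℓ (ℓ - 1) ⋯ (ℓ - i + 1) / i!` with a real upper argument. -/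
def realChoose (ℓ : ℝ) (i : ℕ) : ℝ :=
  (∏ j ∈ Finset.range i, (ℓ - (j : ℝ))) / (i.factorial : ℝ)

/-- The sum `∑_{i ≤ d} (ℓ choose i)`, with the convention that it is `0` for `ℓ < 0`. -/
def chooseLe (ℓ : ℝ) (d : ℕ) : ℝ :=
  if 0 ≤ ℓ then ∑ i ∈ Finset.range (d + 1), realChoose ℓ i else 0

end

/-! Call a point set T shattered if polynomials of degree at most d realise every indicator of a
point of T. On such a T the values of a random f are independent fair bits, so the signed sum of f
over T exceeds δ|T| in absolute value with probability at most 2exp(-δ²|T|/2). Large sets contain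
large shattered sets: the rank of the degree-d functions restricted to A is at least the number of i
< |A| with at most d binary ones (`lowWeightCount_le_finrank_restrictedFun`), and a minimal subset
of A determining these functions is shattered and at least as large as that rank
(`exists_shattered_subset`). Peeling shattered sets greedily off the source writes it as a
nonnegative combination of at most 2^n of their indicators, plus a remainder on fewer than 2^m
points (`exists_family_controlling_weighted_sum`). The remainder has mass at most 2^(m-k), and a
union bound handles the rest. With m = ⌈ℓ⌉ and δ = ε the bias is at most 2ε, and the relevant count
dominates the real binomial sum (`chooseLe_le_lowWeightCount`). -/

/-! ### Integers of small binary weight. -/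

/-- The number of `i < N` whose binary expansion has fewer than `D` ones. -/
def lowWeightCount (D N : ℕ) : ℕ :=
  ∑ i ∈ Finset.range N, if (Nat.digits 2 i).sum < D then 1 else 0

theorem digits_two_sum_double (i : ℕ) :
    (Nat.digits 2 (2 * i)).sum = (Nat.digits 2 i).sum := by
  rcases Nat.eq_zero_or_pos i with rfl | h
  · simp
  · rw [Nat.digits_def' (by norm_num) (by omega)]
    simp

theorem digits_two_sum_double_add_one (i : ℕ) :
    (Nat.digits 2 (2 * i + 1)).sum = (Nat.digits 2 i).sum + 1 := by
  rw [Nat.digits_def' (by norm_num) (by omega), List.sum_cons,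
    show (2 * i + 1) / 2 = i by omega, show (2 * i + 1) % 2 = 1 by omega, add_comm]

theorem lowWeightCount_succ_right (D N : ℕ) : lowWeightCount D (N + 1) =
    lowWeightCount D N + if (Nat.digits 2 N).sum < D then 1 else 0 :=
  Finset.sum_range_succ _ _

@[simp] theorem lowWeightCount_zero_left (N : ℕ) : lowWeightCount 0 N = 0 := by
  simp [lowWeightCount]

@[simp] theorem lowWeightCount_zero_right (D : ℕ) : lowWeightCount D 0 = 0 := by
  simp [lowWeightCount]

@[simp] theorem lowWeightCount_succ_one (D : ℕ) : lowWeightCount (D + 1) 1 = 1 := by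
  rw [lowWeightCount, Finset.sum_range_one]
  simp

theorem lowWeightCount_mono (D : ℕ) : Monotone (lowWeightCount D) :=
  monotone_nat_of_le_succ fun N => by rw [lowWeightCount_succ_right]; omega

/-- Split by the last binary digit: 2i has the weight of i, and 2i + 1 has one more. -/
theorem lowWeightCount_double (D N : ℕ) :
    lowWeightCount (D + 1) (2 * N) = lowWeightCount (D + 1) N + lowWeightCount D N := by
  induction N with
  | zero => simp
  | succ N ih =>
    rw [show 2 * (N + 1) = 2 * N + 1 + 1 by ring, lowWeightCount_succ_right,
      lowWeightCount_succ_right, ih, digits_two_sum_double, digits_two_sum_double_add_one,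
      lowWeightCount_succ_right, lowWeightCount_succ_right]
    simp only [Nat.add_lt_add_iff_right]
    ring

theorem lowWeightCount_double_add_one (D N : ℕ) :
    lowWeightCount (D + 1) (2 * N + 1) =
      lowWeightCount (D + 1) (N + 1) + lowWeightCount D N := by
  rw [lowWeightCount_succ_right, lowWeightCount_double, digits_two_sum_double,
    lowWeightCount_succ_right]
  ring

/-- The difference of the two counts is the number of i of weight exactly D, which grows with the
range. -/
theorem lowWeightCount_succ_sub_mono (D N : ℕ) :
    lowWeightCount (D + 1) N + lowWeightCount D (N + 1) ≤
      lowWeightCount (D + 1) (N + 1) + lowWeightCount D N := by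
  rw [lowWeightCount_succ_right, lowWeightCount_succ_right]
  split_ifs <;> omega

/-- Equality holds at a = b by doubling. Otherwise halve a and b: the doubling formulas reduce the
claim to smaller instances at levels D + 1 and D. This is the numerical recursion matching the split
of a point set along one coordinate. -/
theorem lowWeightCount_add_le (D a b : ℕ) (hab : b ≤ a) :
    lowWeightCount (D + 1) (a + b) ≤ lowWeightCount (D + 1) a + lowWeightCount D b := by
  induction hN : a + b using Nat.strong_induction_on generalizing D a b with
  | _ N ih =>
  subst hN
  rcases Nat.eq_zero_or_pos b with rfl | hb
  · simp
  rcases hab.eq_or_lt with rfl | hlt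
  · rw [← two_mul, lowWeightCount_double]
  -- Truncation in `D - 1` is harmless: at `D = 0` all these counts vanish.
  have key : ∀ D a' b', b' ≤ a' → a' + b' < a + b →
      lowWeightCount D (a' + b') ≤ lowWeightCount D a' + lowWeightCount (D - 1) b' := by
    intro D a' b' h1 h2
    cases D with
    | zero => simp
    | succ D => exact ih _ h2 D a' b' h1 rfl
  have dbl : ∀ D N, lowWeightCount D (2 * N) =
      lowWeightCount D N + lowWeightCount (D - 1) N := by
    intro D N
    cases D with
    | zero => simp
    | succ D => exact lowWeightCount_double D N
  have dbl1 : ∀ D N, lowWeightCount D (2 * N + 1) =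
      lowWeightCount D (N + 1) + lowWeightCount (D - 1) N := by
    intro D N
    cases D with
    | zero => simp
    | succ D => exact lowWeightCount_double_add_one D N
  have diff : ∀ D N, lowWeightCount D N + lowWeightCount (D - 1) (N + 1) ≤
      lowWeightCount D (N + 1) + lowWeightCount (D - 1) N := by
    intro D N
    cases D with
    | zero => simp
    | succ D => exact lowWeightCount_succ_sub_mono D N
  rcases Nat.even_or_odd' a with ⟨a', rfl | rfl⟩ <;> rcases Nat.even_or_odd' b with ⟨b', rfl | rfl⟩
  · rw [← mul_add, dbl, dbl (D + 1) a', dbl D b', Nat.add_sub_cancel]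
    have h1 := key (D + 1) a' b' (by omega) (by omega)
    have h2 := key D a' b' (by omega) (by omega)
    simp only [Nat.add_sub_cancel] at h1
    omega
  · rw [← add_assoc, ← mul_add, dbl1, dbl (D + 1) a', dbl1 D b', Nat.add_sub_cancel]
    have h1 := key (D + 1) a' (b' + 1) (by omega) (by omega)
    have h2 := key D a' b' (by omega) (by omega)
    simp only [Nat.add_sub_cancel, ← add_assoc] at h1
    omega
  · rw [show 2 * a' + 1 + 2 * b' = 2 * (a' + b') + 1 by ring, dbl1, dbl1 (D + 1) a', dbl D b',
      Nat.add_sub_cancel]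
    have h1 := key (D + 1) (a' + 1) b' (by omega) (by omega)
    have h2 := key D a' b' (by omega) (by omega)
    simp only [Nat.add_sub_cancel, show a' + 1 + b' = a' + b' + 1 by ring] at h1
    omega
  · rw [show 2 * a' + 1 + (2 * b' + 1) = 2 * (a' + b' + 1) by ring, dbl, dbl1 (D + 1) a', dbl1 D b',
      Nat.add_sub_cancel]
    have h1 := key (D + 1) (a' + 1) b' (by omega) (by omega)
    have h2 := key D a' (b' + 1) (by omega) (by omega)
    -- With both numbers odd the two instances put the extra unit of b' at the wrong level; this
    -- exchanges it.
    have h3 := diff D b'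
    simp only [Nat.add_sub_cancel, show a' + 1 + b' = a' + b' + 1 by ring] at h1
    simp only [← add_assoc] at h2
    omega

/-! ### Binomial sums with real upper argument. -/

theorem realChoose_succ_succ (ℓ : ℝ) (i : ℕ) :
    realChoose (ℓ + 1) (i + 1) = realChoose ℓ i + realChoose ℓ (i + 1) := by
  have h : ∏ j ∈ Finset.range i, (ℓ + 1 - ((j + 1 : ℕ) : ℝ)) =
      ∏ j ∈ Finset.range i, (ℓ - (j : ℝ)) :=
    Finset.prod_congr rfl fun j _ => by push_cast; ring
  have hi : (i.factorial : ℝ) ≠ 0 := by positivity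
  have hi' : (i + 1 : ℝ) ≠ 0 := by positivity
  unfold realChoose
  rw [Finset.prod_range_succ', h, Finset.prod_range_succ, Nat.factorial_succ]
  push_cast
  field_simp
  ring

@[simp] theorem realChoose_zero_right (ℓ : ℝ) : realChoose ℓ 0 = 1 := by simp [realChoose]

theorem realChoose_succ (ℓ : ℝ) (i : ℕ) :
    realChoose ℓ (i + 1) = realChoose ℓ i * ((ℓ - i) / (i + 1)) := by
  unfold realChoose
  rw [Finset.prod_range_succ, Nat.factorial_succ]
  push_cast
  rw [div_mul_div_comm, mul_comm (i.factorial : ℝ)]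

theorem alternating_sum_mem_Icc (t : ℕ → ℝ) (h0 : ∀ i, 0 ≤ t i) (ht : Antitone t) (D : ℕ) :
    0 ≤ ∑ i ∈ Finset.range D, (-1) ^ i * t i ∧
      ∑ i ∈ Finset.range D, (-1) ^ i * t i ≤ t 0 := by
  induction D generalizing t with
  | zero => simpa using h0 0
  | succ D ih =>
    have h := ih (fun i => t (i + 1)) (fun i => h0 _) (fun i j hij => ht (by omega))
    have h1 := ht (Nat.zero_le 1)
    rw [Finset.sum_range_succ']
    have : ∑ i ∈ Finset.range D, (-1 : ℝ) ^ (i + 1) * t (i + 1) =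
        -∑ i ∈ Finset.range D, (-1 : ℝ) ^ i * t (i + 1) := by
      rw [← Finset.sum_neg_distrib]
      exact Finset.sum_congr rfl fun i _ => by ring
    rw [this]
    simp only [zero_add] at h
    constructor <;> simp <;> linarith [h.1, h.2]

/-- Successive terms have ratio -(i - ℓ)/(i + 1) with (i - ℓ)/(i + 1) in [0, 1], so they alternate
in sign and do not grow; the first term is 1. -/
theorem sum_realChoose_le_one {ℓ : ℝ} (h1 : -1 < ℓ) (h2 : ℓ ≤ 0) (D : ℕ) :
    ∑ i ∈ Finset.range D, realChoose ℓ i ≤ 1 := by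
  have hs : ∀ i, (-1 : ℝ) ^ (i + 1) * realChoose ℓ (i + 1) =
      ((-1) ^ i * realChoose ℓ i) * ((i - ℓ) / (i + 1)) := by
    intro i
    rw [realChoose_succ]
    ring
  have h0 : ∀ i, 0 ≤ (-1 : ℝ) ^ i * realChoose ℓ i := by
    intro i
    induction i with
    | zero => simp
    | succ i ih =>
      rw [hs]
      have : (0 : ℝ) ≤ i := Nat.cast_nonneg i
      exact mul_nonneg ih (div_nonneg (by linarith) (by linarith))
  have ht : Antitone fun i : ℕ => (-1 : ℝ) ^ i * realChoose ℓ i := by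
    refine antitone_nat_of_succ_le fun i => ?_
    rw [hs]
    refine mul_le_of_le_one_right (h0 i) ?_
    have : (0 : ℝ) ≤ i := Nat.cast_nonneg i
    rw [div_le_one (by linarith)]
    linarith
  have := (alternating_sum_mem_Icc _ h0 ht D).2
  simpa [← mul_assoc, ← mul_pow] using this

/-- Pascal's rule on the left and doubling on the right give the same recursion in m. Since real
binomials can be negative, the terms are not compared one by one. -/
theorem sum_realChoose_le_lowWeightCount (m D : ℕ) {ℓ : ℝ} (h1 : (m : ℝ) - 1 < ℓ)
    (h2 : ℓ ≤ m) : ∑ i ∈ Finset.range D, realChoose ℓ i ≤ lowWeightCount D (2 ^ m) := by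
  induction m generalizing D ℓ with
  | zero =>
    cases D with
    | zero => simp
    | succ D =>
      rw [pow_zero, lowWeightCount_succ_one, Nat.cast_one]
      exact sum_realChoose_le_one (by simpa using h1) (by simpa using h2) _
  | succ m ih =>
    cases D with
    | zero => simp
    | succ D =>
      push_cast at h1 h2
      have e1 := ih D (ℓ := ℓ - 1) (by linarith) (by linarith)
      have e2 := ih (D + 1) (ℓ := ℓ - 1) (by linarith) (by linarith)
      rw [pow_succ', lowWeightCount_double, Finset.sum_range_succ']
      have : ∀ i, realChoose ℓ (i + 1) = realChoose (ℓ - 1) i + realChoose (ℓ - 1) (i + 1) :=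
        fun i => by rw [← realChoose_succ_succ, sub_add_cancel]
      simp_rw [this]
      rw [Finset.sum_range_succ', realChoose_zero_right] at e2
      rw [Finset.sum_add_distrib, realChoose_zero_right]
      push_cast
      linarith

theorem chooseLe_le_lowWeightCount {ℓ : ℝ} (hℓ : 0 ≤ ℓ) (d : ℕ) :
    chooseLe ℓ d ≤ lowWeightCount (d + 1) (2 ^ ⌈ℓ⌉₊) := by
  rw [chooseLe, if_pos hℓ]
  exact sum_realChoose_le_lowWeightCount _ _ (by linarith [Nat.ceil_lt_add_one hℓ])
    (Nat.le_ceil ℓ)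

/-! ### Random polynomials on shattered sets. -/

/-- The sign `(-1)^b`. -/
def bitSign (b : ZMod 2) : ℝ := if b = 0 then 1 else -1

theorem bitSign_add_one (b : ZMod 2) : bitSign (b + 1) = -bitSign b := by
  have hz : ∀ b : ZMod 2, b = 0 ∨ b = 1 := by decide
  have h2 : (1 : ZMod 2) + 1 = 0 := by decide
  rcases hz b with rfl | rfl <;> simp [bitSign, h2]

theorem abs_bitSign (b : ZMod 2) : |bitSign b| = 1 := by
  unfold bitSign; split_ifs <;> simp

theorem exp_mul_bitSign_add (t : ℝ) (b : ZMod 2) :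
    Real.exp (t * bitSign b) + Real.exp (t * bitSign (b + 1)) = 2 * Real.cosh t := by
  rw [bitSign_add_one, Real.cosh_eq]
  unfold bitSign
  split_ifs <;> simp <;> ring

theorem mem_lowDegreePolys {n d : ℕ} {f : MvPolynomial (Fin n) (ZMod 2)} :
    f ∈ lowDegreePolys n d ↔ f ∈ polySet n d := Set.Finite.mem_toFinset _

theorem add_mem_polySet {n d : ℕ} {f g : MvPolynomial (Fin n) (ZMod 2)}
    (hf : f ∈ polySet n d) (hg : g ∈ polySet n d) : f + g ∈ polySet n d :=
  ⟨(MvPolynomial.totalDegree_add f g).trans (max_le hf.1 hg.1), fun i =>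
    (MvPolynomial.degreeOf_add_le i f g).trans (max_le (hf.2 i) (hg.2 i))⟩

theorem zero_mem_polySet (n d : ℕ) : (0 : MvPolynomial (Fin n) (ZMod 2)) ∈ polySet n d := by
  simp [polySet]

theorem smul_mem_polySet {n d : ℕ} (c : ZMod 2) {f : MvPolynomial (Fin n) (ZMod 2)}
    (hf : f ∈ polySet n d) : c • f ∈ polySet n d := by
  have hz : ∀ b : ZMod 2, b = 0 ∨ b = 1 := by decide
  rcases hz c with rfl | rfl
  · simpa using zero_mem_polySet n d
  · simpa using hf

/-- A finite set of points is shattered by the degree-`d` polynomials if the indicator function of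
each of its points is the restriction of such a polynomial. -/
def Shattered (n d : ℕ) (T : Finset (Fin n → ZMod 2)) : Prop :=
  ∀ t ∈ T, ∃ e ∈ polySet n d, ∀ x ∈ T, MvPolynomial.eval x e = if x = t then 1 else 0

/-- Independence in exponential-moment form. Adding the indicator polynomial of t is an involution
of the polynomials that flips the sign at t and nothing else on T, so averaging f with f + e splits
off a factor cosh s. -/
theorem sum_exp_bitSign {n d : ℕ} {T : Finset (Fin n → ZMod 2)} (hT : Shattered n d T) (s : ℝ) :
    ∑ f ∈ lowDegreePolys n d, Real.exp (s * ∑ x ∈ T, bitSign (MvPolynomial.eval x f)) =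
      (lowDegreePolys n d).card * Real.cosh s ^ T.card := by
  classical
  suffices h : ∀ U ⊆ T, ∑ f ∈ lowDegreePolys n d,
      Real.exp (s * ∑ x ∈ U, bitSign (MvPolynomial.eval x f)) =
        (lowDegreePolys n d).card * Real.cosh s ^ U.card from h T subset_rfl
  intro U
  induction U using Finset.induction_on with
  | empty => simp
  | insert t U ht ih =>
    intro hU
    obtain ⟨e, he, het⟩ := hT t (hU (Finset.mem_insert_self t U))
    have ih := ih ((Finset.subset_insert t U).trans hU)
    have ee : e + e = 0 := CharTwo.add_self_eq_zero e
    have hflip : ∑ f ∈ lowDegreePolys n d,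
        Real.exp (s * ∑ x ∈ insert t U, bitSign (MvPolynomial.eval x f)) =
        ∑ f ∈ lowDegreePolys n d,
        Real.exp (s * ∑ x ∈ insert t U, bitSign (MvPolynomial.eval x (f + e))) := by
      refine Finset.sum_nbij' (fun f => f + e) (fun f => f + e) ?_ ?_ ?_ ?_ ?_
      · exact fun f hf => mem_lowDegreePolys.2 (add_mem_polySet (mem_lowDegreePolys.1 hf) he)
      · exact fun f hf => mem_lowDegreePolys.2 (add_mem_polySet (mem_lowDegreePolys.1 hf) he)
      · intro f _
        simp [add_assoc, ee]
      · intro f _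
        simp [add_assoc, ee]
      · intro f _
        simp [add_assoc, ee]
    have hsum : ∀ f : MvPolynomial (Fin n) (ZMod 2),
        Real.exp (s * ∑ x ∈ insert t U, bitSign (MvPolynomial.eval x f)) +
          Real.exp (s * ∑ x ∈ insert t U, bitSign (MvPolynomial.eval x (f + e))) =
        2 * Real.cosh s * Real.exp (s * ∑ x ∈ U, bitSign (MvPolynomial.eval x f)) := by
      intro f
      have h1 : ∑ x ∈ U, bitSign (MvPolynomial.eval x (f + e)) =
          ∑ x ∈ U, bitSign (MvPolynomial.eval x f) := by
        refine Finset.sum_congr rfl fun x hx => ?_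
        rw [map_add, het x (hU (Finset.mem_insert_of_mem hx)),
          if_neg (ne_of_mem_of_not_mem hx ht), add_zero]
      rw [Finset.sum_insert ht, Finset.sum_insert ht, h1, map_add,
        het t (hU (Finset.mem_insert_self t U)), if_pos rfl, mul_add, mul_add, Real.exp_add,
        Real.exp_add, ← exp_mul_bitSign_add s (MvPolynomial.eval t f)]
      ring
    have h2 := Finset.sum_congr (rfl : lowDegreePolys n d = _) fun f _ => hsum f
    rw [Finset.sum_add_distrib, ← hflip, ← Finset.mul_sum, ih] at h2
    rw [Finset.card_insert_of_notMem ht, pow_succ]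
    linarith

-- Chernoff's method with parameters δ and -δ, using cosh δ ≤ exp(δ²/2).
open Classical in
theorem card_filter_bitSign_sum_gt {n d : ℕ} {T : Finset (Fin n → ZMod 2)}
    (hT : Shattered n d T) {δ : ℝ} (hδ : 0 ≤ δ) :
    (((lowDegreePolys n d).filter fun f =>
      ¬ |∑ x ∈ T, bitSign (MvPolynomial.eval x f)| ≤ δ * T.card).card : ℝ) ≤
      2 * Real.exp (-(δ ^ 2 * T.card / 2)) * (lowDegreePolys n d).card := by
  set S : MvPolynomial (Fin n) (ZMod 2) → ℝ :=
    fun f => ∑ x ∈ T, bitSign (MvPolynomial.eval x f) with hS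
  set G := lowDegreePolys n d
  have hcosh : Real.cosh δ ^ T.card ≤ Real.exp (δ ^ 2 * T.card / 2) := by
    refine (pow_le_pow_left₀ (Real.cosh_pos δ).le (Real.cosh_le_exp_half_sq δ) _).trans ?_
    rw [← Real.exp_nat_mul]
    exact Real.exp_le_exp.2 (by ring_nf; rfl)
  have hpt : ∀ f, (if ¬ |S f| ≤ δ * T.card then (1 : ℝ) else 0) ≤
      Real.exp (-(δ ^ 2 * T.card)) * (Real.exp (δ * S f) + Real.exp (-δ * S f)) := by
    intro f
    by_cases h : |S f| ≤ δ * T.card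
    · rw [if_neg (not_not.2 h)]
      positivity
    · rw [if_pos h]
      rw [not_le, lt_abs] at h
      rw [mul_add, ← Real.exp_add, ← Real.exp_add]
      rcases h with h | h
      · have : 0 ≤ -(δ ^ 2 * T.card) + δ * S f := by nlinarith
        linarith [Real.one_le_exp this, Real.exp_pos (-(δ ^ 2 * T.card) + -δ * S f)]
      · have : 0 ≤ -(δ ^ 2 * T.card) + -δ * S f := by nlinarith
        linarith [Real.one_le_exp this, Real.exp_pos (-(δ ^ 2 * T.card) + δ * S f)]
  rw [Finset.card_filter]
  push_cast
  refine (Finset.sum_le_sum fun f _ => hpt f).trans ?_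
  rw [← Finset.mul_sum, Finset.sum_add_distrib, sum_exp_bitSign hT, sum_exp_bitSign hT,
    Real.cosh_neg]
  calc _ = 2 * (Real.exp (-(δ ^ 2 * T.card)) * Real.cosh δ ^ T.card) * G.card := by ring
    _ ≤ 2 * (Real.exp (-(δ ^ 2 * T.card)) * Real.exp (δ ^ 2 * T.card / 2)) * G.card := by gcongr
    _ = _ := by rw [← Real.exp_add]; congr 3; ring

/-! ### Greedy decomposition of a weight function. -/

/-- A nonnegative weight function is, up to a remainder of small support, a nonnegative combination
of indicator functions of sets satisfying `Q`, if every large set contains such a set. -/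
theorem exists_family_controlling_weighted_sum {V : Type*} [Fintype V] [DecidableEq V]
    {Q : Finset V → Prop} {N : ℕ}
    (hQ : ∀ A : Finset V, N ≤ A.card → ∃ T ⊆ A, T.Nonempty ∧ Q T) {c : ℝ} (hc : 0 ≤ c)
    (p : V → ℝ) (hp : ∀ x, 0 ≤ p x) (hpc : ∀ x, p x ≤ c) :
    ∃ 𝒯 : Finset (Finset V), 𝒯.card ≤ (Finset.univ.filter fun x => p x ≠ 0).card ∧
      (∀ T ∈ 𝒯, Q T) ∧ ∀ (g : V → ℝ) (δ : ℝ), (∀ x, |g x| ≤ 1) →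
        0 ≤ δ → (∀ T ∈ 𝒯, |∑ x ∈ T, g x| ≤ δ * T.card) →
        |∑ x, p x * g x| ≤ δ * ∑ x, p x + c * N := by
  induction hs : (Finset.univ.filter fun x => p x ≠ 0).card using Nat.strong_induction_on
    generalizing p with
  | _ s ih =>
  subst hs
  set A := Finset.univ.filter fun x => p x ≠ 0 with hA
  by_cases hN : N ≤ A.card
  · obtain ⟨T, hTA, hTne, hTQ⟩ := hQ A hN
    -- The minimum of p on T is the largest multiple of the indicator of T that can be removed. It
    -- kills the weight at t, so each set costs a support point.
    obtain ⟨t, htT, htmin⟩ := T.exists_min_image p hTne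
    set q : V → ℝ := fun x => p x - if x ∈ T then p t else 0 with hq
    have hq0 : ∀ x, 0 ≤ q x := by
      intro x
      simp only [hq]
      split_ifs with h
      · linarith [htmin x h]
      · linarith [hp x]
    have hqp : ∀ x, q x ≤ p x := by
      intro x
      simp only [hq]
      split_ifs <;> linarith [hp t]
    have hsub : (Finset.univ.filter fun x => q x ≠ 0) ⊂ A := by
      rw [Finset.ssubset_iff_of_subset]
      · exact ⟨t, hTA htT, by simp [hq, htT]⟩
      · intro x hx
        simp only [hA, Finset.mem_filter, Finset.mem_univ, true_and] at hx ⊢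
        intro h0
        exact hx (le_antisymm (h0 ▸ hqp x) (hq0 x))
    obtain ⟨𝒯, hcard, h𝒯Q, h𝒯⟩ := ih _ (Finset.card_lt_card hsub) q hq0
      (fun x => (hqp x).trans (hpc x)) rfl
    refine ⟨insert T 𝒯, ?_, ?_, ?_⟩
    · have := Finset.card_insert_le T 𝒯
      have := Finset.card_lt_card hsub
      omega
    · intro U hU
      rcases Finset.mem_insert.1 hU with rfl | hU
      · exact hTQ
      · exact h𝒯Q U hU
    · intro g δ hg hδ hT
      have h1 := h𝒯 g δ hg hδ fun U hU => hT U (Finset.mem_insert_of_mem hU)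
      have h2 := hT T (Finset.mem_insert_self _ _)
      have e1 : ∑ x, p x * g x = ∑ x, q x * g x + p t * ∑ x ∈ T, g x := by
        simp only [hq, sub_mul, Finset.sum_sub_distrib, ite_mul, zero_mul, Finset.sum_ite_mem,
          Finset.univ_inter, Finset.mul_sum]
        ring
      have e2 : ∑ x, p x = ∑ x, q x + p t * T.card := by
        simp only [hq, Finset.sum_sub_distrib, Finset.sum_ite_mem,
          Finset.univ_inter, Finset.sum_const, nsmul_eq_mul]
        ring
      rw [e1, e2]
      refine (abs_add_le _ _).trans ?_
      rw [abs_mul, abs_of_nonneg (hp t)]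
      nlinarith [mul_le_mul_of_nonneg_left h2 (hp t)]
  -- Fewer than N support points remain, each contributing at most c.
  · refine ⟨∅, by simp, by simp, fun g δ hg hδ _ => ?_⟩
    have h1 : |∑ x, p x * g x| ≤ ∑ x ∈ A, c := by
      rw [← Finset.sum_subset (Finset.subset_univ A)]
      · refine (Finset.abs_sum_le_sum_abs _ _).trans (Finset.sum_le_sum fun x _ => ?_)
        rw [abs_mul, abs_of_nonneg (hp x)]
        nlinarith [hp x, hpc x, hg x, abs_nonneg (g x)]
      · intro x _ hx
        have : p x = 0 := by simpa [hA] using hx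
        simp [this]
    rw [Finset.sum_const, nsmul_eq_mul] at h1
    have h2 : (A.card : ℝ) ≤ N := by exact_mod_cast (not_le.1 hN).le
    have h3 : 0 ≤ δ * ∑ x, p x := mul_nonneg hδ (Finset.sum_nonneg fun x _ => hp x)
    nlinarith

/-! ### Rank of low-degree functions on a point set. -/

/-- The function `x ↦ ∏_{i ∈ S} x_i`. -/
def monomialFun {n : ℕ} (S : Finset (Fin n)) : (Fin n → ZMod 2) → ZMod 2 :=
  fun x => ∏ i ∈ S, x i

/-- The space of functions on the cube spanned by products of fewer than `D` coordinates. -/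
def lowDegreeFun (n D : ℕ) : Submodule (ZMod 2) ((Fin n → ZMod 2) → ZMod 2) :=
  Submodule.span (ZMod 2) {f | ∃ S : Finset (Fin n), S.card < D ∧ monomialFun S = f}

theorem monomialFun_mem {n D : ℕ} {S : Finset (Fin n)} (hS : S.card < D) :
    monomialFun S ∈ lowDegreeFun n D :=
  Submodule.subset_span ⟨S, hS, rfl⟩

theorem comp_tail_mem_lowDegreeFun {n D : ℕ} {f : (Fin n → ZMod 2) → ZMod 2}
    (hf : f ∈ lowDegreeFun n D) :
    (fun x : Fin (n + 1) → ZMod 2 => f (Fin.tail x)) ∈ lowDegreeFun (n + 1) D := by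
  induction hf using Submodule.span_induction with
  | mem f hf =>
    obtain ⟨S, hS, rfl⟩ := hf
    have : (fun x : Fin (n + 1) → ZMod 2 => monomialFun S (Fin.tail x)) =
        monomialFun (S.map (Fin.succEmb n)) := by
      ext x
      simp [monomialFun, Fin.tail]
    rw [this]
    exact monomialFun_mem (by simpa using hS)
  | zero => exact Submodule.zero_mem _
  | add f g _ _ hf hg => exact Submodule.add_mem _ hf hg
  | smul c f _ hf => exact Submodule.smul_mem _ c hf

theorem head_mul_comp_tail_mem_lowDegreeFun {n D : ℕ} {f : (Fin n → ZMod 2) → ZMod 2}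
    (hf : f ∈ lowDegreeFun n D) :
    (fun x : Fin (n + 1) → ZMod 2 => x 0 * f (Fin.tail x)) ∈ lowDegreeFun (n + 1) (D + 1) := by
  induction hf using Submodule.span_induction with
  | mem f hf =>
    obtain ⟨S, hS, rfl⟩ := hf
    have h0 : (0 : Fin (n + 1)) ∉ S.map (Fin.succEmb n) := by simp [Fin.succ_ne_zero]
    have : (fun x : Fin (n + 1) → ZMod 2 => x 0 * monomialFun S (Fin.tail x)) =
        monomialFun (Finset.cons 0 (S.map (Fin.succEmb n)) h0) := by
      ext x
      simp [monomialFun, Fin.tail]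
    rw [this]
    exact monomialFun_mem (by simpa using hS)
  | zero =>
    simp only [Pi.zero_apply, mul_zero]
    exact Submodule.zero_mem _
  | add f g _ _ hf hg =>
    simp only [Pi.add_apply, mul_add]
    exact Submodule.add_mem _ hf hg
  | smul c f _ hf =>
    simp only [Pi.smul_apply, mul_smul_comm]
    exact Submodule.smul_mem _ c hf

theorem exists_mem_polySet_of_mem_lowDegreeFun {n d : ℕ} {f : (Fin n → ZMod 2) → ZMod 2}
    (hf : f ∈ lowDegreeFun n (d + 1)) :
    ∃ P ∈ polySet n d, ∀ x, MvPolynomial.eval x P = f x := by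
  induction hf using Submodule.span_induction with
  | mem f hf =>
    obtain ⟨S, hS, rfl⟩ := hf
    refine ⟨∏ i ∈ S, MvPolynomial.X i, ⟨?_, fun j => ?_⟩, fun x => ?_⟩
    · refine (MvPolynomial.totalDegree_finsetProd _ _).trans ?_
      simp only [MvPolynomial.totalDegree_X, Finset.sum_const, smul_eq_mul, mul_one]
      omega
    · refine (MvPolynomial.degreeOf_prod_le j S _).trans ?_
      simp only [MvPolynomial.degreeOf_X, Finset.sum_ite_eq]
      split_ifs <;> simp
    · simp [monomialFun]
  | zero => exact ⟨0, zero_mem_polySet n d, by simp⟩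
  | add f g _ _ hf hg =>
    obtain ⟨P, hP, hPf⟩ := hf
    obtain ⟨R, hR, hRg⟩ := hg
    exact ⟨P + R, add_mem_polySet hP hR, fun x => by simp [hPf, hRg]⟩
  | smul c f _ hf =>
    obtain ⟨P, hP, hPf⟩ := hf
    exact ⟨c • P, smul_mem_polySet c hP, fun x => by simp [hPf]⟩

/-- The restrictions to `A` of the functions in `lowDegreeFun n D`. -/
def restrictedFun {n : ℕ} (D : ℕ) (A : Finset (Fin n → ZMod 2)) : Submodule (ZMod 2) (A → ZMod 2) :=
  (lowDegreeFun n D).map (LinearMap.funLeft (ZMod 2) (ZMod 2) (Subtype.val : A → _))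

/-- The points `y` such that both `(0, y)` and `(1, y)` lie in `A`. -/
def doubleTail {n : ℕ} (A : Finset (Fin (n + 1) → ZMod 2)) : Finset (Fin n → ZMod 2) :=
  Finset.univ.filter fun y =>
    (Fin.cons 0 y : Fin (n + 1) → ZMod 2) ∈ A ∧ (Fin.cons 1 y : Fin (n + 1) → ZMod 2) ∈ A

/-- Inclusion-exclusion for the slices of A at first coordinate 0 and 1: the tails form their union,
the double tails their intersection. -/
theorem card_image_tail_add_card_doubleTail {n : ℕ} (A : Finset (Fin (n + 1) → ZMod 2)) :
    (A.image Fin.tail).card + (doubleTail A).card = A.card := by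
  set A0 : Finset (Fin n → ZMod 2) :=
    Finset.univ.filter fun y => (Fin.cons 0 y : Fin (n + 1) → ZMod 2) ∈ A with hA0
  set A1 : Finset (Fin n → ZMod 2) :=
    Finset.univ.filter fun y => (Fin.cons 1 y : Fin (n + 1) → ZMod 2) ∈ A with hA1
  have hz : ∀ b : ZMod 2, b = 0 ∨ b = 1 := by decide
  have hU : A.image Fin.tail = A0 ∪ A1 := by
    ext y
    simp only [Finset.mem_image, Finset.mem_union, hA0, hA1, Finset.mem_filter, Finset.mem_univ,
      true_and]
    constructor
    · rintro ⟨x, hx, rfl⟩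
      rw [← Fin.cons_self_tail x] at hx
      rcases hz (x 0) with h | h <;> rw [h] at hx
      · exact Or.inl hx
      · exact Or.inr hx
    · rintro (h | h)
      · exact ⟨_, h, Fin.tail_cons _ _⟩
      · exact ⟨_, h, Fin.tail_cons _ _⟩
  have hI : doubleTail A = A0 ∩ A1 := by
    ext y
    simp [doubleTail, hA0, hA1]
  have hinj : ∀ b : ZMod 2, Function.Injective
      fun y : Fin n → ZMod 2 => (Fin.cons b y : Fin (n + 1) → ZMod 2) :=
    fun b => Fin.cons_right_injective (α := fun _ => ZMod 2) b
  have h0 : A0.card = (A.filter fun x => x 0 = 0).card := by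
    rw [← Finset.card_image_of_injective _ (hinj 0)]
    congr 1
    ext x
    simp only [hA0, Finset.mem_image, Finset.mem_filter, Finset.mem_univ, true_and]
    constructor
    · rintro ⟨y, hy, rfl⟩
      exact ⟨hy, rfl⟩
    · rintro ⟨hx, h⟩
      have : (Fin.cons 0 (Fin.tail x) : Fin (n + 1) → ZMod 2) = x := by
        rw [← h, Fin.cons_self_tail]
      exact ⟨Fin.tail x, by rwa [this], this⟩
  have h1 : A1.card = (A.filter fun x => ¬ x 0 = 0).card := by
    rw [← Finset.card_image_of_injective _ (hinj 1)]
    congr 1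
    ext x
    simp only [hA1, Finset.mem_image, Finset.mem_filter, Finset.mem_univ, true_and]
    constructor
    · rintro ⟨y, hy, rfl⟩
      exact ⟨hy, by simp⟩
    · rintro ⟨hx, h⟩
      have : (Fin.cons 1 (Fin.tail x) : Fin (n + 1) → ZMod 2) = x := by
        rw [← (hz (x 0)).resolve_left h, Fin.cons_self_tail]
      exact ⟨Fin.tail x, by rwa [this], this⟩
  rw [hU, hI, Finset.card_union_add_card_inter, h0, h1]
  exact Finset.card_filter_add_card_filter_not _

/-- Rank-nullity for the difference of values at (1, y) and (0, y). Functions of the tail alone lie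
in its kernel, and x₀·f(tail x) is sent to f, so multiplying by x₀ accounts for the drop of one
degree. -/
theorem finrank_restrictedFun_add_le {n D : ℕ} (A : Finset (Fin (n + 1) → ZMod 2)) :
    Module.finrank (ZMod 2) (restrictedFun (D + 1) (A.image Fin.tail)) +
      Module.finrank (ZMod 2) (restrictedFun D (doubleTail A)) ≤
      Module.finrank (ZMod 2) (restrictedFun (D + 1) A) := by
  set V := restrictedFun (D + 1) A with hV
  have hC : ∀ y : doubleTail A, (Fin.cons 0 y.1 : Fin (n + 1) → ZMod 2) ∈ A ∧
      (Fin.cons 1 y.1 : Fin (n + 1) → ZMod 2) ∈ A := fun y => by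
    simpa [doubleTail] using y.2
  let δ : (A → ZMod 2) →ₗ[ZMod 2] (doubleTail A → ZMod 2) :=
    LinearMap.funLeft (ZMod 2) (ZMod 2) (fun y => (⟨_, (hC y).2⟩ : A)) -
      LinearMap.funLeft (ZMod 2) (ZMod 2) (fun y => (⟨_, (hC y).1⟩ : A))
  let π : A → A.image Fin.tail := fun x => ⟨Fin.tail x.1, Finset.mem_image_of_mem _ x.2⟩
  have hπ : Function.Surjective π := by
    rintro ⟨y, hy⟩
    obtain ⟨x, hx, rfl⟩ := Finset.mem_image.1 hy
    exact ⟨⟨x, hx⟩, rfl⟩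
  let Φ := LinearMap.funLeft (ZMod 2) (ZMod 2) π
  have hΦ : Function.Injective Φ := LinearMap.funLeft_injective_of_surjective _ _ _ hπ
  have hrank := LinearMap.finrank_range_add_finrank_ker (δ.domRestrict V)
  have hrange : restrictedFun D (doubleTail A) ≤ LinearMap.range (δ.domRestrict V) := by
    rintro _ ⟨f, hf, rfl⟩
    refine ⟨⟨_, Submodule.mem_map_of_mem (head_mul_comp_tail_mem_lowDegreeFun hf)⟩, ?_⟩
    ext y
    simp [δ, LinearMap.funLeft_apply]
  have hker : (restrictedFun (D + 1) (A.image Fin.tail)).map Φ ≤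
      (LinearMap.ker (δ.domRestrict V)).map V.subtype := by
    rintro _ ⟨_, ⟨f, hf, rfl⟩, rfl⟩
    refine ⟨⟨_, Submodule.mem_map_of_mem (comp_tail_mem_lowDegreeFun hf)⟩, ?_, ?_⟩
    · rw [SetLike.mem_coe, LinearMap.mem_ker]
      ext y
      simp [δ, LinearMap.funLeft_apply]
    · ext x
      simp [Φ, π, LinearMap.funLeft_apply]
  have e1 := Submodule.finrank_mono hrange
  have e2 := Submodule.finrank_mono hker
  rw [← (Submodule.equivMapOfInjective Φ hΦ _).finrank_eq,
    ← (Submodule.equivMapOfInjective _ V.injective_subtype _).finrank_eq] at e2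
  omega

theorem lowWeightCount_le_finrank_restrictedFun {n : ℕ} (D : ℕ) (A : Finset (Fin n → ZMod 2)) :
    lowWeightCount D A.card ≤ Module.finrank (ZMod 2) (restrictedFun D A) := by
  induction n generalizing D with
  | zero =>
    cases D with
    | zero => simp
    | succ D =>
      rcases A.eq_empty_or_nonempty with rfl | ⟨a, ha⟩
      · simp
      · have h1 : A.card = 1 := by
          refine le_antisymm ?_ (Finset.card_pos.2 ⟨a, ha⟩)
          exact (Finset.card_le_univ A).trans (by simp)
        rw [h1, lowWeightCount_succ_one, Nat.one_le_iff_ne_zero]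
        intro h
        have hbot := Submodule.finrank_eq_zero.1 h
        have hmem : LinearMap.funLeft (ZMod 2) (ZMod 2) (Subtype.val : A → _)
            (monomialFun (∅ : Finset (Fin 0))) ∈ restrictedFun (D + 1) A :=
          Submodule.mem_map_of_mem (monomialFun_mem (by simp))
        rw [hbot, Submodule.mem_bot] at hmem
        have := congrFun hmem ⟨a, ha⟩
        simp [LinearMap.funLeft_apply, monomialFun] at this
  | succ n ih =>
    cases D with
    | zero => simp
    | succ D =>
      rw [← card_image_tail_add_card_doubleTail A]
      have hle : (doubleTail A).card ≤ (A.image Fin.tail).card :=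
        Finset.card_le_card fun y hy => Finset.mem_image.2
          ⟨_, (Finset.mem_filter.1 hy).2.1, Fin.tail_cons _ _⟩
      refine (lowWeightCount_add_le D _ _ hle).trans ?_
      exact (add_le_add (ih _ _) (ih _ _)).trans (finrank_restrictedFun_add_le A)

/-- Take T of least size such that a low-degree function vanishing on T vanishes on A. Restriction
to T is then injective, so |T| is at least the rank. By minimality, each t in T has a function
vanishing on the rest of T but not at t; over two elements its value there is 1. -/
theorem exists_shattered_subset {n : ℕ} (d : ℕ) (A : Finset (Fin n → ZMod 2)) :
    ∃ T ⊆ A, lowWeightCount (d + 1) A.card ≤ T.card ∧ Shattered n d T := by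
  classical
  let p : Finset (Fin n → ZMod 2) → Prop := fun T =>
    ∀ f ∈ lowDegreeFun n (d + 1), (∀ x ∈ T, f x = 0) → ∀ x ∈ A, f x = 0
  have hne : (A.powerset.filter p).Nonempty :=
    ⟨A, Finset.mem_filter.2 ⟨Finset.mem_powerset_self A, fun f _ h => h⟩⟩
  obtain ⟨T, hT, hmin⟩ := Finset.exists_min_image _ Finset.card hne
  rw [Finset.mem_filter, Finset.mem_powerset] at hT
  obtain ⟨hTA, hTp⟩ := hT
  refine ⟨T, hTA, (lowWeightCount_le_finrank_restrictedFun _ A).trans ?_, fun t ht => ?_⟩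
  · let ρ : (A → ZMod 2) →ₗ[ZMod 2] (T → ZMod 2) :=
      LinearMap.funLeft (ZMod 2) (ZMod 2) fun x => (⟨x.1, hTA x.2⟩ : A)
    have hinj : Function.Injective (ρ.domRestrict (restrictedFun (d + 1) A)) := by
      rw [← LinearMap.ker_eq_bot, LinearMap.ker_eq_bot']
      rintro ⟨_, f, hf, rfl⟩ h0
      ext x
      exact hTp f hf (fun y hy => congrFun h0 ⟨y, hy⟩) x.1 x.2
    simpa using LinearMap.finrank_le_finrank_of_injective hinj
  · have hnp : ¬ p (T.erase t) := fun hp => by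
      have := hmin (T.erase t) (Finset.mem_filter.2
        ⟨Finset.mem_powerset.2 ((Finset.erase_subset t T).trans hTA), hp⟩)
      exact absurd (Finset.card_erase_lt_of_mem ht) (not_lt.2 this)
    simp only [p, not_forall] at hnp
    obtain ⟨f, hf, hf0, y, hy, hfy⟩ := hnp
    have hft : f t ≠ 0 := fun h => hfy <| hTp f hf (fun x hx => by
      by_cases hxt : x = t
      · rw [hxt, h]
      · exact hf0 x (Finset.mem_erase.2 ⟨hxt, hx⟩)) y hy
    obtain ⟨P, hP, hPf⟩ := exists_mem_polySet_of_mem_lowDegreeFun hf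
    have hz : ∀ b : ZMod 2, b ≠ 0 → b = 1 := by decide
    refine ⟨P, hP, fun x hx => ?_⟩
    rw [hPf]
    split_ifs with hxt
    · rw [hxt]
      exact hz _ hft
    · exact hf0 x (Finset.mem_erase.2 ⟨hxt, hx⟩)

/-! ### From bias to extraction, and the union bound. -/

theorem toReal_le_of_le_minEntropy {n : ℕ} {X : PMF (Fin n → ZMod 2)} {k : ℝ}
    (hX : k ≤ minEntropy X) (x : Fin n → ZMod 2) : (X x).toReal ≤ 2 ^ (-k) := by
  by_cases hx : X x = 0
  · rw [hx, ENNReal.toReal_zero]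
    positivity
  · have hpos : 0 < (X x).toReal := ENNReal.toReal_pos hx (X.apply_ne_top x)
    have h : k ≤ -Real.logb 2 (X x).toReal :=
      hX.trans (ciInf_le (f := fun x : X.support => -Real.logb 2 (X (x : Fin n → ZMod 2)).toReal)
        (Set.finite_range _).bddBelow ⟨x, (X.mem_support_iff x).2 hx⟩)
    rw [← Real.logb_le_iff_le_rpow one_lt_two hpos]
    linarith

theorem sum_toReal_eq_one {α : Type*} [Fintype α] (X : PMF α) : ∑ x, (X x).toReal = 1 := by
  rw [← ENNReal.toReal_sum fun x _ => X.apply_ne_top x, ← tsum_fintype (L := .unconditional _),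
    X.tsum_coe, ENNReal.toReal_one]

theorem toReal_map_one {n : ℕ} (X : PMF (Fin n → ZMod 2)) (g : (Fin n → ZMod 2) → ZMod 2) :
    ((X.map g) 1).toReal = 1 / 2 - (∑ x, (X x).toReal * bitSign (g x)) / 2 := by
  classical
  have hz : ∀ b : ZMod 2, b ≠ 0 → b = 1 := by decide
  rw [PMF.map_apply, tsum_fintype, ENNReal.toReal_sum (fun x _ => by
    split_ifs
    · exact X.apply_ne_top x
    · simp), ← sum_toReal_eq_one X, ← sub_div, ← Finset.sum_sub_distrib, Finset.sum_div]
  refine Finset.sum_congr rfl fun x _ => ?_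
  unfold bitSign
  by_cases h : g x = 0
  · simp [h]
  · simp [hz _ h]

theorem statDist_uniform_bit (Y : PMF (ZMod 2)) :
    statDist Y (PMF.uniformOfFintype (ZMod 2)) = |(Y 1).toReal - 1 / 2| := by
  have hsum : ∀ F : ZMod 2 → ℝ, ∑ x, F x = F 0 + F 1 := fun F => Fin.sum_univ_two F
  have h := sum_toReal_eq_one Y
  rw [hsum] at h
  have h0 : (Y 0).toReal - 1 / 2 = -((Y 1).toReal - 1 / 2) := by linarith
  have hc : (PMF.uniformOfFintype (ZMod 2) 0).toReal = 1 / 2 ∧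
      (PMF.uniformOfFintype (ZMod 2) 1).toReal = 1 / 2 := by
    simp [PMF.uniformOfFintype_apply, ZMod.card]
  rw [statDist, hsum, hc.1, hc.2, h0, abs_neg]
  ring

theorem probRandomPoly_mono {n d : ℕ} {P Q : MvPolynomial (Fin n) (ZMod 2) → Prop}
    (h : ∀ f, P f → Q f) : probRandomPoly n d P ≤ probRandomPoly n d Q := by
  classical
  unfold probRandomPoly
  gcongr with f
  exact h f

theorem probRandomPoly_nonneg (n d : ℕ) (P : MvPolynomial (Fin n) (ZMod 2) → Prop) :
    0 ≤ probRandomPoly n d P := by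
  unfold probRandomPoly
  positivity

open Classical in
theorem one_sub_le_probRandomPoly_of_card_le {n d : ℕ} {P : MvPolynomial (Fin n) (ZMod 2) → Prop}
    {η : ℝ} (h : (((lowDegreePolys n d).filter fun f => ¬ P f).card : ℝ) ≤
      η * (lowDegreePolys n d).card) : 1 - η ≤ probRandomPoly n d P := by
  have hpos : (0 : ℝ) < (lowDegreePolys n d).card := by
    exact_mod_cast Finset.card_pos.2 (lowDegreePolys_nonempty n d)
  have hsplit : (((lowDegreePolys n d).filter P).card : ℝ) +
      ((lowDegreePolys n d).filter fun f => ¬ P f).card = (lowDegreePolys n d).card := by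
    exact_mod_cast Finset.card_filter_add_card_filter_not _
  unfold probRandomPoly
  rw [le_div_iff₀ hpos]
  convert (by linarith : (1 - η) * ((lowDegreePolys n d).card : ℝ) ≤
    ((lowDegreePolys n d).filter P).card)

/-- A random degree-`d` polynomial has small bias with respect to a bounded distribution. -/
theorem probRandomPoly_bias_le {n d m : ℕ} {X : PMF (Fin n → ZMod 2)} {c δ : ℝ} (hc : 0 ≤ c)
    (hX : ∀ x, (X x).toReal ≤ c) (hδ : 0 ≤ δ) :
    1 - 2 ^ n * (2 * Real.exp (-(δ ^ 2 * lowWeightCount (d + 1) (2 ^ m) / 2))) ≤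
      probRandomPoly n d fun f =>
        |∑ x, (X x).toReal * bitSign (MvPolynomial.eval x f)| ≤ δ + c * 2 ^ m := by
  classical
  set M := lowWeightCount (d + 1) (2 ^ m) with hM
  have hMpos : 0 < M := by
    have := lowWeightCount_mono (d + 1) (Nat.one_le_two_pow (n := m))
    rw [lowWeightCount_succ_one] at this
    exact this
  obtain ⟨𝒯, hcard, hQ, hbias⟩ := exists_family_controlling_weighted_sum
    (Q := fun T => M ≤ T.card ∧ Shattered n d T) (N := 2 ^ m)
    (fun A hA => by
      obtain ⟨T, hTA, hT, hsh⟩ := exists_shattered_subset d A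
      have hMT : M ≤ T.card := (lowWeightCount_mono (d + 1) hA).trans hT
      exact ⟨T, hTA, Finset.card_pos.1 (hMpos.trans_le hMT), hMT, hsh⟩)
    hc (fun x => (X x).toReal) (fun x => ENNReal.toReal_nonneg) hX
  have hcard' : (𝒯.card : ℝ) ≤ 2 ^ n := by
    have : 𝒯.card ≤ 2 ^ n := by
      refine hcard.trans ((Finset.card_le_univ _).trans ?_)
      simp [ZMod.card]
    exact_mod_cast this
  apply one_sub_le_probRandomPoly_of_card_le
  -- A polynomial of large bias must fail on some set of the family, since the source has total mass
  -- 1.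
  have hsub : ((lowDegreePolys n d).filter fun f =>
      ¬ |∑ x, (X x).toReal * bitSign (MvPolynomial.eval x f)| ≤ δ + c * 2 ^ m) ⊆
      𝒯.biUnion fun T => (lowDegreePolys n d).filter fun f =>
        ¬ |∑ x ∈ T, bitSign (MvPolynomial.eval x f)| ≤ δ * T.card := by
    intro f hf
    rw [Finset.mem_filter] at hf
    by_contra hcon
    simp only [Finset.mem_biUnion, Finset.mem_filter, not_exists, not_and, not_not] at hcon
    have := hbias (fun x => bitSign (MvPolynomial.eval x f)) δ (fun x => (abs_bitSign _).le) hδ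
      fun T hT => hcon T hT hf.1
    rw [sum_toReal_eq_one, mul_one] at this
    exact hf.2 (by exact_mod_cast this)
  calc _ ≤ ((𝒯.biUnion fun T => (lowDegreePolys n d).filter fun f =>
        ¬ |∑ x ∈ T, bitSign (MvPolynomial.eval x f)| ≤ δ * T.card).card : ℝ) := by
        exact_mod_cast Finset.card_le_card hsub
    _ ≤ ∑ T ∈ 𝒯, (((lowDegreePolys n d).filter fun f =>
        ¬ |∑ x ∈ T, bitSign (MvPolynomial.eval x f)| ≤ δ * T.card).card : ℝ) := by
        exact_mod_cast Finset.card_biUnion_le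
    _ ≤ ∑ T ∈ 𝒯, 2 * Real.exp (-(δ ^ 2 * M / 2)) * (lowDegreePolys n d).card := by
        refine Finset.sum_le_sum fun T hT => (card_filter_bitSign_sum_gt (hQ T hT).2 hδ).trans ?_
        have : (M : ℝ) ≤ T.card := by exact_mod_cast (hQ T hT).1
        gcongr
    _ ≤ 2 ^ n * (2 * Real.exp (-(δ ^ 2 * M / 2))) * (lowDegreePolys n d).card := by
        rw [Finset.sum_const, nsmul_eq_mul, mul_assoc (2 ^ n)]
        gcongr

/-! ### Constants and conclusion. -/

/-- Rounding ℓ up costs a factor of at most 2, so the remainder has mass at most 2^(-k/2)·ε/(16n),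
well below ε. -/
theorem two_pow_ceil_mul_le {n k : ℕ} (hn : 1 ≤ n) {ε ℓ : ℝ} (hε : 0 < ε) (h0 : 0 ≤ ℓ)
    (hℓ : ℓ = (k : ℝ) / 2 - Real.logb 2 (32 * (n : ℝ) / ε)) :
    (2 : ℝ) ^ (-(k : ℝ)) * 2 ^ ⌈ℓ⌉₊ ≤ ε := by
  have hn' : (1 : ℝ) ≤ n := by exact_mod_cast hn
  have h1 : (2 : ℝ) ^ ⌈ℓ⌉₊ ≤ 2 ^ (ℓ + 1) := by
    rw [← Real.rpow_natCast]
    exact Real.rpow_le_rpow_of_exponent_le one_le_two (Nat.ceil_lt_add_one h0).le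
  have hk : (0 : ℝ) ≤ k := Nat.cast_nonneg k
  calc (2 : ℝ) ^ (-(k : ℝ)) * 2 ^ ⌈ℓ⌉₊ ≤ 2 ^ (-(k : ℝ)) * 2 ^ (ℓ + 1) := by gcongr
    _ = 2 ^ (-(k : ℝ) / 2 + 1 - Real.logb 2 (32 * (n : ℝ) / ε)) := by
        rw [← Real.rpow_add two_pos, hℓ]
        congr 1
        ring
    _ ≤ 2 ^ (1 - Real.logb 2 (32 * (n : ℝ) / ε)) :=
        Real.rpow_le_rpow_of_exponent_le one_le_two (by linarith)
    _ = 2 / (32 * (n : ℝ) / ε) := by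
        rw [Real.rpow_sub two_pos, Real.rpow_one,
          Real.rpow_logb two_pos (by norm_num) (by positivity)]
    _ ≤ ε := by
        rw [div_div_eq_mul_div, div_le_iff₀ (by positivity)]
        nlinarith

/-- The union-bound factor 2^(n+1) is absorbed by exp(3n); the divisor Cn² is only a weakening of 2.
-/
theorem two_pow_mul_exp_le {n : ℕ} (hn : 1 ≤ n) {ε a M : ℝ} (ha : a ≤ M) (hM : 0 ≤ M) :
    2 ^ n * (2 * Real.exp (-(ε ^ 2 * M / 2))) ≤
      Real.exp (3 * (n : ℝ) - ε ^ 2 * a / (7 * 32 ^ 2 * (n : ℝ) ^ 2)) := by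
  have hn' : (1 : ℝ) ≤ n := by exact_mod_cast hn
  have h2 : (2 : ℝ) ≤ Real.exp 1 := by linarith [Real.add_one_le_exp (1 : ℝ)]
  have h3 : (2 : ℝ) ^ n * 2 ≤ Real.exp (3 * n) := by
    calc (2 : ℝ) ^ n * 2 = 2 ^ (n + 1) := (pow_succ _ _).symm
      _ ≤ Real.exp 1 ^ (n + 1) := pow_le_pow_left₀ two_pos.le h2 _
      _ = Real.exp (n + 1) := by rw [← Real.exp_nat_mul]; push_cast; ring_nf
      _ ≤ Real.exp (3 * n) := Real.exp_le_exp.2 (by linarith)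
  have h4 : ε ^ 2 * a / (7 * 32 ^ 2 * (n : ℝ) ^ 2) ≤ ε ^ 2 * M / 2 := by
    calc ε ^ 2 * a / (7 * 32 ^ 2 * (n : ℝ) ^ 2) ≤ ε ^ 2 * M / (7 * 32 ^ 2 * (n : ℝ) ^ 2) := by
          gcongr
      _ ≤ ε ^ 2 * M / 2 := by
          gcongr
          nlinarith
  rw [← mul_assoc]
  calc _ ≤ Real.exp (3 * n) * Real.exp (-(ε ^ 2 * M / 2)) := by gcongr
    _ = Real.exp (3 * n - ε ^ 2 * M / 2) := by rw [← Real.exp_add, sub_eq_add_neg]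
    _ ≤ _ := Real.exp_le_exp.2 (by linarith)

theorem mainTheorem5 (n d k : ℕ) (hn : 1 ≤ n) (hd : 1 ≤ d) (hk : 1 ≤ k)
    (ε : ℝ) (hε : 0 < ε)
    (X : PMF (Fin n → ZMod 2)) (hX : (k : ℝ) ≤ minEntropy X)
    (ℓ C : ℝ) (hℓ : ℓ = (k : ℝ) / 2 - Real.logb 2 (32 * (n : ℝ) / ε))
    (hC : C = 7 * 32 ^ 2) :
    1 - Real.exp (3 * (n : ℝ) - ε ^ 2 * chooseLe ℓ d / (C * (n : ℝ) ^ 2)) ≤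
      probRandomPoly n d (fun f =>
        IsExtractorFor (fun x => MvPolynomial.eval x f) ε X ∧
        |((X.map (fun x => MvPolynomial.eval x f)) 1).toReal - 1 / 2| ≤ ε) := by
  rcases lt_or_ge ℓ 0 with h0 | h0
  -- For negative ℓ the exponent is 3n, so the claimed lower bound is at most 0.
  · refine le_trans ?_ (probRandomPoly_nonneg _ _ _)
    rw [chooseLe, if_neg (not_le.2 h0), mul_zero, zero_div, sub_zero, sub_nonpos]
    exact Real.one_le_exp (by positivity)
  · have h1 := probRandomPoly_bias_le (d := d) (m := ⌈ℓ⌉₊) (by positivity)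
      (toReal_le_of_le_minEntropy hX) hε.le
    have h2 := two_pow_mul_exp_le (ε := ε) hn (chooseLe_le_lowWeightCount h0 d)
      (Nat.cast_nonneg _)
    rw [hC]
    refine (sub_le_sub_left h2 1).trans (h1.trans (probRandomPoly_mono fun f hf => ?_))
    have hb : |((X.map (fun x => MvPolynomial.eval x f)) 1).toReal - 1 / 2| ≤ ε := by
      rw [toReal_map_one, sub_sub_cancel_left, abs_neg, abs_div, abs_two]
      -- The bias is at most ε + ε, and the deviation from 1/2 is half of it.
      linarith [two_pow_ceil_mul_le hn hε h0 hℓ]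
    exact ⟨(statDist_uniform_bit _).trans_le hb, hb⟩
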